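/- Let $G$ be a finite connected simple undirected graph with $n$ vertices and $m$ edges, let $s$ be a vertex of $G$ (the only sink), and let $\sigma\in\mathbb{N}^{V(G)}$ be a chip configuration with $N$ chips in total on the non-sink vertices. A configuration is terminal if every vertex $v\ne s$ has fewer than $\deg v$ chips. Firing a vertex $u\neq s$ that has at least $\deg u$ chips removes $\deg u$ chips from $u$ and adds one chip to each neighbor of $u$ other than $s$ (chips sent to the sink disappear). The greedy simulation repeats the following iteration as long as the configuration is not terminal: choose a vertex $u\neq s$ for which $k=\lfloor \sigma_u/\deg u\rfloor$ is as large as possible (ties are broken arbitrarily) and fire $u$ exactly $k$ times at once. Let $R$ be the maximum effective resistance between $s$ and any other vertex, where every edge has unit resistance. Then the greedy simulation performs only legal firings, it stops only at a terminal configuration, and it terminates in $O(Rm^2\log(nN))$ iterations: there is an absolute constant $C>0$ such that, for all $G$, $s$, $\sigma$ and all ways of breaking ties, the number of iterations is at most $C\,R\,m^2\log(nN)$ (if $N=0$ or $n=1$, there are no iterations). -/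

import Mathlib

open scoped Matrix

/-- The chip configuration `σ` is terminal for the sink `s`: every vertex other than the sink
has fewer chips than its degree. -/
def IsTerminal {V : Type*} [Fintype V] (G : SimpleGraph V) [DecidableRel G.Adj]
    (s : V) (σ : V → ℕ) : Prop :=
  ∀ v, v ≠ s → σ v < G.degree v

/-- Fire the vertex `u` `k` times at once: `u` loses `k * degree u` chips and each neighbor of `u`
other than the sink `s` gains `k` chips. Chips sent to the sink are removed. (It is only used
when `k * degree u ≤ σ u`, so that the subtraction does not truncate.) -/
def fireTimes {V : Type*} [Fintype V] [DecidableEq V] (G : SimpleGraph V) [DecidableRel G.Adj]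
    (s u : V) (k : ℕ) (σ : V → ℕ) : V → ℕ :=
  fun v => if v = u then σ u - k * G.degree u
    else if v ≠ s ∧ G.Adj u v then σ v + k
    else σ v

/-- `σ'` arises from `σ` by a single legal firing of a full vertex other than the sink. -/
def LegalFiring {V : Type*} [Fintype V] [DecidableEq V] (G : SimpleGraph V) [DecidableRel G.Adj]
    (s : V) (σ σ' : V → ℕ) : Prop :=
  ∃ u, u ≠ s ∧ G.degree u ≤ σ u ∧ σ' = fireTimes G s u 1 σ

/-- `τ` arises from `σ` by a finite (possibly empty) sequence of single legal firings. -/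
def FiringReachable {V : Type*} [Fintype V] [DecidableEq V] (G : SimpleGraph V)
    [DecidableRel G.Adj] (s : V) : (V → ℕ) → (V → ℕ) → Prop :=
  Relation.ReflTransGen (LegalFiring G s)

/-- One iteration of the greedy simulation: as `σ` is not terminal, a non-sink vertex `u` that
maximizes `⌊σ u / degree u⌋` (any such `u`, if there are several) fires that many times. -/
def GreedyStep {V : Type*} [Fintype V] [DecidableEq V] (G : SimpleGraph V) [DecidableRel G.Adj]
    (s : V) (σ σ' : V → ℕ) : Prop :=
  ¬ IsTerminal G s σ ∧
    ∃ u, u ≠ s ∧ (∀ v, v ≠ s → σ v / G.degree v ≤ σ u / G.degree u) ∧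
      σ' = fireTimes G s u (σ u / G.degree u) σ

/-- `GreedyRun G s T σ τ`: some execution of the greedy simulation that starts from `σ` is
at `τ` after exactly `T` iterations. -/
inductive GreedyRun {V : Type*} [Fintype V] [DecidableEq V] (G : SimpleGraph V)
    [DecidableRel G.Adj] (s : V) : ℕ → (V → ℕ) → (V → ℕ) → Prop
  | start (σ : V → ℕ) : GreedyRun G s 0 σ σ
  | next {T : ℕ} {σ τ τ' : V → ℕ} (h : GreedyRun G s T σ τ) (hs : GreedyStep G s τ τ') :
      GreedyRun G s (T + 1) σ τ'

/-- `φ` is a potential on the network `G` with unit resistances for which a unit current enters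
at `u` and leaves at `v` (Kirchhoff's and Ohm's laws): `L φ = 1_u - 1_v`, with `L` the
Laplacian. -/
def IsUnitPotential {V : Type*} [Fintype V] [DecidableEq V] (G : SimpleGraph V)
    [DecidableRel G.Adj] (u v : V) (φ : V → ℝ) : Prop :=
  G.lapMatrix ℝ *ᵥ φ = Pi.single u 1 - Pi.single v 1

/-- On a connected graph unit potentials exist. -/
theorem exists_isUnitPotential {V : Type*} [Fintype V] [DecidableEq V] (G : SimpleGraph V)
    [DecidableRel G.Adj] (hG : G.Connected) (u v : V) : ∃ φ, IsUnitPotential G u v φ := by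
  have := hG.nonempty
  have hn : (Fintype.card V : ℝ) ≠ 0 := by exact_mod_cast Fintype.card_ne_zero
  have hsum : ∀ φ : V → ℝ, ∑ w, (G.lapMatrix ℝ *ᵥ φ) w = 0 := by
    intro φ
    have h1 := congrArg (fun x => x ⬝ᵥ φ) (G.lapMatrix_mulVec_const_eq_zero (R := ℝ))
    have h2 : (fun _ : V => (1 : ℝ)) ⬝ᵥ (G.lapMatrix ℝ *ᵥ φ) = 0 := by
      rw [Matrix.dotProduct_mulVec, ← Matrix.mulVec_transpose, (G.isSymm_lapMatrix (R := ℝ)).eq]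
      simpa using h1
    simpa [dotProduct] using h2
  let A : (V → ℝ) →ₗ[ℝ] (V → ℝ) :=
    (G.lapMatrix ℝ).mulVecLin +
      LinearMap.pi (fun _ : V => ∑ w : V, (LinearMap.proj w : (V → ℝ) →ₗ[ℝ] ℝ))
  have hA : ∀ φ w, A φ w = (G.lapMatrix ℝ *ᵥ φ) w + ∑ x, φ x := by
    intro φ w; simp [A]
  have hAs : ∀ φ, ∑ w, A φ w = Fintype.card V * ∑ x, φ x := by
    intro φ
    simp only [hA, Finset.sum_add_distrib, hsum]
    simp
  have hinj : Function.Injective A := by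
    rw [injective_iff_map_eq_zero]
    intro φ h
    have h0 : ∑ x, φ x = 0 := by
      have := hAs φ
      rw [h] at this
      simpa [hn] using this.symm
    have hL : G.lapMatrix ℝ *ᵥ φ = 0 := by
      ext w
      have := hA φ w
      rw [h, h0] at this
      simpa using this.symm
    rw [SimpleGraph.lapMatrix_mulVec_eq_zero_iff_forall_reachable] at hL
    ext w
    have hc : ∀ x, φ x = φ w := fun x => hL x w (hG.preconnected x w)
    simp only [hc, Finset.sum_const, Finset.card_univ, nsmul_eq_mul] at h0
    simpa [hn] using h0
  obtain ⟨φ, hφ⟩ := (LinearMap.injective_iff_surjective.mp hinj) (Pi.single u 1 - Pi.single v 1)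
  have h0 : ∑ x, φ x = 0 := by
    have := hAs φ
    rw [hφ] at this
    simpa [hn, Finset.sum_sub_distrib] using this.symm
  refine ⟨φ, ?_⟩
  unfold IsUnitPotential
  rw [← hφ]
  ext w
  rw [hA, h0, add_zero]

open Classical in
/-- The effective resistance between `u` and `v`: the difference of potentials `φ u - φ v` when
a unit current flows from `u` to `v`. -/
noncomputable def effectiveResistance {V : Type*} [Fintype V] [DecidableEq V] (G : SimpleGraph V)
    [DecidableRel G.Adj] (u v : V) : ℝ :=
  if h : ∃ φ, IsUnitPotential G u v φ then h.choose u - h.choose v else 0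

/-- On a connected graph, every unit potential gives the effective resistance. -/
theorem effectiveResistance_eq {V : Type*} [Fintype V] [DecidableEq V] (G : SimpleGraph V)
    [DecidableRel G.Adj] (hG : G.Connected) (u v : V) (φ : V → ℝ)
    (hφ : IsUnitPotential G u v φ) : effectiveResistance G u v = φ u - φ v := by
  have h : ∃ φ, IsUnitPotential G u v φ := ⟨φ, hφ⟩
  rw [effectiveResistance, dif_pos h]
  have hL : G.lapMatrix ℝ *ᵥ (h.choose - φ) = 0 := by
    have h1 : G.lapMatrix ℝ *ᵥ h.choose = Pi.single u 1 - Pi.single v 1 := h.choose_spec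
    unfold IsUnitPotential at hφ
    rw [Matrix.mulVec_sub, h1, hφ, sub_self]
  rw [SimpleGraph.lapMatrix_mulVec_eq_zero_iff_forall_reachable] at hL
  have := hL u v (hG.preconnected u v)
  simp only [Pi.sub_apply] at this
  linarith

/-- The maximum effective resistance between the sink `s` and any other vertex. -/
noncomputable def maxEffectiveResistance {V : Type*} [Fintype V] [DecidableEq V]
    (G : SimpleGraph V) [DecidableRel G.Adj] (s : V) : ℝ :=
  ⨆ v : {v : V // v ≠ s}, effectiveResistance G v s

/-- The total number of chips on the non-sink vertices. -/
def chipCount {V : Type*} [Fintype V] [DecidableEq V] (s : V) (σ : V → ℕ) : ℕ :=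
  ∑ v ∈ Finset.univ.erase s, σ v

/-! Weight a chip at `v` by the expected time `w v` a random walk from `v` needs to reach `s`, and
let `Φ` be the total weight. Since `L w = deg` off the sink and `w s = 0`, firing `u` `k` times
lowers `Φ` by exactly `k * deg u` (`sum_fireTimes_mul`). If `k` is the greedy maximum, there are at
most `4 m k` chips (`chipCount_le`), and `w ≤ 2 m R` (`exists_hittingTime`), so `Φ` is at most `A =
8 m² R` times the drop. Each iteration thus shrinks `Φ` by a factor `1 - 1/A` or better, while `Φ ≥
1` before every iteration. Hence all iterations but the last number at most `A log Φ(σ)`, and `Φ(σ)`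
is polynomial in `n N`. -/

open Finset

/-! ### Electrical potentials, resistance bounds and hitting times -/

section Potential

variable {V : Type*} [Fintype V] [DecidableEq V] (G : SimpleGraph V) [DecidableRel G.Adj]

theorem lapMatrix_mulVec_apply_eq_sum_sub (φ : V → ℝ) (v : V) :
    (G.lapMatrix ℝ *ᵥ φ) v = ∑ y ∈ G.neighborFinset v, (φ v - φ y) := by
  rw [SimpleGraph.lapMatrix_mulVec_apply, Finset.sum_sub_distrib]
  simp

variable {G}

/-- Maximum principle: a function that is subharmonic away from `x` is maximal at `x`. -/
theorem le_of_lapMatrix_mulVec_nonpos (hG : G.Connected) {φ : V → ℝ} {x : V}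
    (h : ∀ v, v ≠ x → (G.lapMatrix ℝ *ᵥ φ) v ≤ 0) (v : V) : φ v ≤ φ x := by
  have := hG.nonempty
  obtain ⟨a, ha⟩ := Finite.exists_max φ
  -- Maximality spreads along a walk to `x`: at a maximal `b ≠ x` the differences to the neighbors
  -- are nonnegative with sum at most 0, so they vanish.
  have key : ∀ {b c : V}, G.Walk b c → c = x → φ b = φ a → φ x = φ a := by
    intro b c p
    induction p with
    | nil => rintro rfl hb; exact hb
    | @cons b c d hbc p ih =>
      intro hd hb
      by_cases hbx : b = x
      · rw [← hbx, hb]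
      · refine ih hd ?_
        have h1 := h b hbx
        rw [lapMatrix_mulVec_apply_eq_sum_sub] at h1
        have h2 : ∀ y ∈ G.neighborFinset b, 0 ≤ φ b - φ y := fun y _ => by
          rw [hb]; linarith [ha y]
        have h3 := Finset.single_le_sum h2 ((G.mem_neighborFinset b c).2 hbc)
        linarith [ha c]
  obtain ⟨p⟩ := hG.preconnected a x
  rw [key p rfl rfl]
  exact ha v

theorem exists_grounded_unitPotential (hG : G.Connected) (x s : V) :
    ∃ φ : V → ℝ, IsUnitPotential G x s φ ∧ φ s = 0 := by
  obtain ⟨φ, hφ⟩ := exists_isUnitPotential G hG x s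
  refine ⟨fun v => φ v - φ s, ?_, by simp⟩
  unfold IsUnitPotential at *
  rw [← hφ]
  ext v
  simp [lapMatrix_mulVec_apply_eq_sum_sub]

theorem IsUnitPotential.le_source (hG : G.Connected) {x s : V} {φ : V → ℝ}
    (hφ : IsUnitPotential G x s φ) (v : V) : φ v ≤ φ x := by
  refine le_of_lapMatrix_mulVec_nonpos hG (fun v hv => ?_) v
  rw [hφ]
  by_cases hs : v = s <;> simp [Pi.single_apply, hv, hs]
  split_ifs <;> simp

theorem IsUnitPotential.sink_le (hG : G.Connected) {x s : V} {φ : V → ℝ}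
    (hφ : IsUnitPotential G x s φ) (v : V) : φ s ≤ φ v := by
  have h := le_of_lapMatrix_mulVec_nonpos hG (φ := -φ) (x := s) (fun v hv => ?_) v
  · simpa using h
  rw [Matrix.mulVec_neg, hφ]
  by_cases hs : v = x <;> simp [Pi.single_apply, hv, hs]
  split_ifs <;> simp

/-- The Dirichlet energy of a unit potential is `φ x - φ s`, and one edge carries at most all of it.
The factor 2 is lossy: only one orientation of the edge is kept from the sum over ordered pairs. -/
theorem IsUnitPotential.sq_sub_le {x s : V} {φ : V → ℝ}
    (hφ : IsUnitPotential G x s φ) {a b : V} (hab : G.Adj a b) :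
    (φ a - φ b) ^ 2 ≤ 2 * (φ x - φ s) := by
  have h1 := G.lapMatrix_toLinearMap₂' (R := ℝ) φ
  rw [Matrix.toLinearMap₂'_apply', hφ, dotProduct_sub, dotProduct_single, dotProduct_single] at h1
  have h2 : (φ a - φ b) ^ 2 ≤ ∑ i, ∑ j, if G.Adj i j then (φ i - φ j) ^ 2 else 0 := by
    have h3 : ∀ i j, 0 ≤ if G.Adj i j then (φ i - φ j) ^ 2 else (0 : ℝ) := fun i j => by
      split_ifs <;> positivity
    calc (φ a - φ b) ^ 2 = if G.Adj a b then (φ a - φ b) ^ 2 else 0 := by rw [if_pos hab]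
      _ ≤ ∑ j, if G.Adj a j then (φ a - φ j) ^ 2 else 0 :=
        Finset.single_le_sum (f := fun j => if G.Adj a j then (φ a - φ j) ^ 2 else 0)
          (fun j _ => h3 a j) (Finset.mem_univ b)
      _ ≤ _ := Finset.single_le_sum
          (f := fun i => ∑ j, if G.Adj i j then (φ i - φ j) ^ 2 else 0)
          (fun i _ => Finset.sum_nonneg fun j _ => h3 i j) (Finset.mem_univ a)
  linarith

omit [Fintype V] [DecidableEq V] [DecidableRel G.Adj] in
theorem sub_le_length_mul {φ : V → ℝ} {c : ℝ} (h : ∀ a b, G.Adj a b → φ a - φ b ≤ c)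
    {a b : V} (p : G.Walk a b) : φ a - φ b ≤ p.length * c := by
  induction p with
  | nil => simp
  | cons hab p ih =>
    have := h _ _ hab
    rw [SimpleGraph.Walk.length_cons]
    push_cast
    linarith

theorem effectiveResistance_nonneg (hG : G.Connected) (x s : V) :
    0 ≤ effectiveResistance G x s := by
  obtain ⟨φ, hφ⟩ := exists_isUnitPotential G hG x s
  rw [effectiveResistance_eq G hG x s φ hφ]
  linarith [hφ.sink_le hG x]

/-- Adding the edge bound along a path gives `r ≤ n √(2r)`. This crude estimate is used only inside
the logarithm. -/
theorem effectiveResistance_le (hG : G.Connected) (x s : V) :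
    effectiveResistance G x s ≤ 2 * (Fintype.card V : ℝ) ^ 2 := by
  obtain ⟨φ, hφ⟩ := exists_isUnitPotential G hG x s
  have h0 := effectiveResistance_nonneg hG x s
  rw [effectiveResistance_eq G hG x s φ hφ] at *
  obtain ⟨p, hp⟩ := (hG.preconnected x s).exists_isPath
  have hl : (p.length : ℝ) ≤ Fintype.card V := by exact_mod_cast hp.length_lt.le
  set r := φ x - φ s
  have h1 : r ≤ p.length * √(2 * r) := sub_le_length_mul
    (fun a b hab => Real.le_sqrt_of_sq_le (hφ.sq_sub_le hab)) p
  have h2 : r ≤ Fintype.card V * √(2 * r) :=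
    h1.trans (mul_le_mul_of_nonneg_right hl (Real.sqrt_nonneg _))
  have h3 : √(2 * r) ^ 2 = 2 * r := Real.sq_sqrt (by linarith)
  nlinarith [sq_nonneg (√(2 * r) - 2 * Fintype.card V)]

theorem effectiveResistance_le_max {x s : V} (hx : x ≠ s) :
    effectiveResistance G x s ≤ maxEffectiveResistance G s :=
  le_ciSup (f := fun v : {v : V // v ≠ s} => effectiveResistance G v s)
    (Set.finite_range _).bddAbove ⟨x, hx⟩

theorem maxEffectiveResistance_nonneg (hG : G.Connected) (s : V) :
    0 ≤ maxEffectiveResistance G s :=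
  Real.iSup_nonneg fun v => effectiveResistance_nonneg hG v s

theorem maxEffectiveResistance_le (hG : G.Connected) (s : V) :
    maxEffectiveResistance G s ≤ 2 * (Fintype.card V : ℝ) ^ 2 :=
  Real.iSup_le (fun v => effectiveResistance_le hG v s) (by positivity)

omit [DecidableEq V] in
theorem sum_degree_eq (G : SimpleGraph V) [DecidableRel G.Adj] :
    ∑ v, (G.degree v : ℝ) = 2 * (#G.edgeFinset : ℝ) := by
  exact_mod_cast G.sum_degrees_eq_twice_card_edges

/-- The expected hitting times of the sink, with the bound given by the commute time identity. -/
theorem exists_hittingTime (hG : G.Connected) (s : V) :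
    ∃ w : V → ℝ, w s = 0 ∧ (∀ v, 0 ≤ w v) ∧
      (∀ v, w v ≤ 2 * (#G.edgeFinset : ℝ) * maxEffectiveResistance G s) ∧
      ∀ v, v ≠ s → (G.lapMatrix ℝ *ᵥ w) v = G.degree v := by
  choose φ hφ hs using fun x => exists_grounded_unitPotential hG x s
  have hnn : ∀ x v, 0 ≤ φ x v := fun x v => by rw [← hs x]; exact (hφ x).sink_le hG v
  have hle : ∀ x, x ≠ s → ∀ v, φ x v ≤ maxEffectiveResistance G s := fun x hx v => by
    have h1 := effectiveResistance_le_max (G := G) hx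
    rw [effectiveResistance_eq G hG x s _ (hφ x), hs, sub_zero] at h1
    exact ((hφ x).le_source hG v).trans h1
  -- Superposition: inject current `deg x` at every `x ≠ s` and ground the sink. Each `φ x` peaks at
  -- its source, where it equals the effective resistance.
  refine ⟨∑ x ∈ univ.erase s, (G.degree x : ℝ) • φ x, ?_, fun v => ?_, fun v => ?_,
    fun v hv => ?_⟩
  · simp [hs]
  · simp only [Finset.sum_apply, Pi.smul_apply, smul_eq_mul]
    exact Finset.sum_nonneg fun x _ => mul_nonneg (Nat.cast_nonneg _) (hnn x v)
  · simp only [Finset.sum_apply, Pi.smul_apply, smul_eq_mul]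
    calc ∑ x ∈ univ.erase s, (G.degree x : ℝ) * φ x v
        ≤ ∑ x ∈ univ.erase s, (G.degree x : ℝ) * maxEffectiveResistance G s :=
          Finset.sum_le_sum fun x hx =>
            mul_le_mul_of_nonneg_left (hle x (Finset.ne_of_mem_erase hx) v) (Nat.cast_nonneg _)
      _ ≤ ∑ x, (G.degree x : ℝ) * maxEffectiveResistance G s :=
          Finset.sum_le_sum_of_subset_of_nonneg (Finset.erase_subset _ _) fun x _ _ =>
            mul_nonneg (Nat.cast_nonneg _) (maxEffectiveResistance_nonneg hG s)
      _ = _ := by rw [← Finset.sum_mul, sum_degree_eq]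
  · have h1 : ∀ x, G.lapMatrix ℝ *ᵥ φ x = Pi.single x 1 - Pi.single s 1 := hφ
    rw [Matrix.mulVec_sum]
    simp only [Matrix.mulVec_smul, h1, Finset.sum_apply, Pi.smul_apply, Pi.sub_apply, smul_eq_mul,
      Pi.single_apply, if_neg hv, sub_zero]
    simp [hv]

end Potential

/-! ### Legality of firings and decay of the potential -/

section Firing

variable {V : Type*} [Fintype V] [DecidableEq V] {G : SimpleGraph V} [DecidableRel G.Adj]

theorem fireTimes_zero (s u : V) (σ : V → ℕ) : fireTimes G s u 0 σ = σ := by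
  ext v
  simp only [fireTimes]
  split_ifs <;> simp_all

theorem fireTimes_succ (s u : V) (k : ℕ) (σ : V → ℕ) :
    fireTimes G s u (k + 1) σ = fireTimes G s u 1 (fireTimes G s u k σ) := by
  ext v
  simp only [fireTimes]
  split_ifs <;> simp_all
  · rw [add_mul, one_mul, Nat.sub_add_eq]
  · omega

theorem firingReachable_fireTimes {s u : V} (hu : u ≠ s) {k : ℕ} {σ : V → ℕ}
    (hk : k * G.degree u ≤ σ u) : FiringReachable G s σ (fireTimes G s u k σ) := by
  induction k with
  | zero => rw [fireTimes_zero]; exact Relation.ReflTransGen.refl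
  | succ k ih =>
    rw [add_mul, one_mul] at hk
    refine (ih (by omega)).tail ⟨u, hu, ?_, fireTimes_succ s u k σ⟩
    simp only [fireTimes, if_true]
    omega

theorem GreedyStep.firingReachable {s : V} {σ τ : V → ℕ} (h : GreedyStep G s σ τ) :
    FiringReachable G s σ τ := by
  obtain ⟨-, u, hu, -, rfl⟩ := h
  exact firingReachable_fireTimes hu (Nat.div_mul_le_self _ _)

theorem GreedyRun.firingReachable {s : V} {T : ℕ} {σ τ : V → ℕ} (h : GreedyRun G s T σ τ) :
    FiringReachable G s σ τ := by
  induction h with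
  | start => exact Relation.ReflTransGen.refl
  | next _ hs ih => exact ih.trans hs.firingReachable

theorem isTerminal_or_exists_greedyStep (s : V) (τ : V → ℕ) :
    IsTerminal G s τ ∨ ∃ τ', GreedyStep G s τ τ' := by
  by_cases h : IsTerminal G s τ
  · exact Or.inl h
  · right
    have h' := h
    unfold IsTerminal at h'
    push Not at h'
    obtain ⟨v, hv, -⟩ := h'
    obtain ⟨u, hu, hmax⟩ := (univ.erase s).exists_max_image (fun v => τ v / G.degree v)
      ⟨v, by simp [hv]⟩
    exact ⟨_, h, u, Finset.ne_of_mem_erase hu, fun v hv => hmax v (by simp [hv]), rfl⟩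

/-- Firing subtracts `k` times row `u` of the Laplacian, except at the sink, where the weight is
zero. -/
theorem sum_fireTimes_mul {s u : V} {k : ℕ} {σ : V → ℕ} (hk : k * G.degree u ≤ σ u)
    {w : V → ℝ} (hw : w s = 0) :
    ∑ v, (fireTimes G s u k σ v : ℝ) * w v =
      ∑ v, (σ v : ℝ) * w v - k * (G.lapMatrix ℝ *ᵥ w) u := by
  have h1 : ∀ v, (fireTimes G s u k σ v : ℝ) * w v =
      (σ v : ℝ) * w v - (if v = u then k * G.degree u * w u else 0) +
        (if G.Adj u v then k * w v else 0) := by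
    intro v
    simp only [fireTimes]
    by_cases hvu : v = u
    · subst hvu
      simp [Nat.cast_sub hk]
      ring
    · by_cases hvs : v = s
      · subst hvs
        simp [hvu, hw]
      · by_cases ha : G.Adj u v
        · simp [hvu, hvs, ha]; ring
        · simp [hvu, ha]
  simp only [h1, Finset.sum_add_distrib, Finset.sum_sub_distrib]
  rw [SimpleGraph.lapMatrix_mulVec_apply, Finset.sum_ite_eq' univ u,
    ← Finset.sum_filter, ← SimpleGraph.neighborFinset_eq_filter G, ← Finset.mul_sum]
  simp
  ring

omit [DecidableEq V] in
theorem degree_pos_of_connected (hG : G.Connected) {s v : V} (hv : v ≠ s) : 0 < G.degree v :=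
  have : Nontrivial V := ⟨⟨v, s, hv⟩⟩
  hG.preconnected.degree_pos_of_nontrivial v

omit [DecidableEq V] in
theorem one_le_div_degree (hG : G.Connected) {s u : V} {σ : V → ℕ} (h : ¬ IsTerminal G s σ)
    (hmax : ∀ v, v ≠ s → σ v / G.degree v ≤ σ u / G.degree u) : 1 ≤ σ u / G.degree u := by
  unfold IsTerminal at h
  push Not at h
  obtain ⟨v, hv, hd⟩ := h
  exact ((Nat.one_le_div_iff (degree_pos_of_connected hG hv)).2 hd).trans (hmax v hv)

/-- Each `v ≠ s` has fewer than `(k + 1) deg v ≤ 2 k deg v` chips, and the degrees sum to `2 m`. -/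
theorem chipCount_le (hG : G.Connected) {s : V} {σ : V → ℕ} {k : ℕ} (hk : 1 ≤ k)
    (hmax : ∀ v, v ≠ s → σ v / G.degree v ≤ k) :
    chipCount s σ ≤ 4 * #G.edgeFinset * k := by
  calc chipCount s σ ≤ ∑ v ∈ univ.erase s, 2 * k * G.degree v := by
        refine Finset.sum_le_sum fun v hv => ?_
        have hv := Finset.ne_of_mem_erase hv
        have h1 := Nat.lt_mul_div_succ (σ v) (degree_pos_of_connected hG hv)
        have h2 : G.degree v * (σ v / G.degree v + 1) ≤ G.degree v * (2 * k) :=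
          Nat.mul_le_mul_left _ (by have := hmax v hv; omega)
        linarith
    _ ≤ ∑ v, 2 * k * G.degree v :=
        Finset.sum_le_sum_of_subset (Finset.erase_subset _ _)
    _ = 4 * #G.edgeFinset * k := by
        rw [← Finset.mul_sum, G.sum_degrees_eq_twice_card_edges]; ring

theorem sum_mul_le_chipCount {s : V} (σ : V → ℕ) {w : V → ℝ} {B : ℝ} (hw : w s = 0)
    (hB : ∀ v, w v ≤ B) : ∑ v, (σ v : ℝ) * w v ≤ B * chipCount s σ := by
  rw [← Finset.add_sum_erase _ _ (Finset.mem_univ s), hw, mul_zero, zero_add, chipCount,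
    Nat.cast_sum, Finset.mul_sum]
  exact Finset.sum_le_sum fun v _ => by
    rw [mul_comm]; exact mul_le_mul_of_nonneg_right (hB v) (Nat.cast_nonneg _)

theorem GreedyStep.potential_drop (hG : G.Connected) {s : V} {σ τ : V → ℕ}
    (h : GreedyStep G s σ τ) {w : V → ℝ} {B : ℝ} (hs : w s = 0)
    (hB : ∀ v, w v ≤ B) (hL : ∀ v, v ≠ s → (G.lapMatrix ℝ *ᵥ w) v = G.degree v) :
    (∑ v, (τ v : ℝ) * w v) + 1 ≤ ∑ v, (σ v : ℝ) * w v ∧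
    ∑ v, (σ v : ℝ) * w v ≤
      4 * (#G.edgeFinset : ℝ) * B * (∑ v, (σ v : ℝ) * w v - ∑ v, (τ v : ℝ) * w v) := by
  obtain ⟨hnt, u, hu, hmax, rfl⟩ := h
  have hk := one_le_div_degree hG hnt hmax
  have hd := degree_pos_of_connected hG hu
  have hchip := chipCount_le hG hk hmax
  have hsum := sum_fireTimes_mul (G := G) (u := u) (Nat.div_mul_le_self (σ u) (G.degree u)) hs
  have hbound := sum_mul_le_chipCount σ hs hB
  rw [hsum, hL u hu]
  set k := σ u / G.degree u
  have hk' : (1 : ℝ) ≤ k := by exact_mod_cast hk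
  have hd' : (1 : ℝ) ≤ G.degree u := by exact_mod_cast hd
  have hchip' : (chipCount s σ : ℝ) ≤ 4 * #G.edgeFinset * k := by exact_mod_cast hchip
  have hB0 : 0 ≤ B := hs ▸ hB s
  have hkd : (k : ℝ) ≤ k * G.degree u := le_mul_of_one_le_right (by linarith) hd'
  constructor
  · linarith
  · calc ∑ v, (σ v : ℝ) * w v ≤ B * chipCount s σ := hbound
      _ ≤ B * (4 * #G.edgeFinset * (k * G.degree u)) := by
        refine mul_le_mul_of_nonneg_left (hchip'.trans ?_) hB0
        exact mul_le_mul_of_nonneg_left hkd (by positivity)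
      _ = _ := by ring

/-- Geometric decay with ratio `1 - 1/A`, measured on a logarithmic scale. -/
theorem add_mul_log_le {A a b : ℝ} (hb : 0 < b) (ha : 0 < a) (hA : 0 ≤ A)
    (h : a ≤ A * (a - b)) : 1 + A * Real.log b ≤ A * Real.log a := by
  have h1 : Real.log b - Real.log a ≤ b / a - 1 := by
    rw [← Real.log_div hb.ne' ha.ne']
    exact Real.log_le_sub_one_of_pos (by positivity)
  have h2 : 1 ≤ A * (1 - b / a) := by
    have : A * (1 - b / a) = A * (a - b) / a := by field_simp
    rw [this, one_le_div ha]
    exact h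
  nlinarith [mul_le_mul_of_nonneg_left h1 hA]

theorem GreedyRun.length_le_of_potential {s : V} {T : ℕ} {σ τ : V → ℕ}
    (h : GreedyRun G s T σ τ) {Φ : (V → ℕ) → ℝ} {A : ℝ} (hA : 0 ≤ A)
    (hstep : ∀ σ τ, GreedyStep G s σ τ → Φ τ + 1 ≤ Φ σ ∧ Φ σ ≤ A * (Φ σ - Φ τ))
    (hΦ : 0 < Φ τ) : T + A * Real.log (Φ τ) ≤ A * Real.log (Φ σ) := by
  induction h with
  | start => simp
  | @next T σ τ τ' _ hs ih =>
    obtain ⟨h1, h2⟩ := hstep _ _ hs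
    have h3 := add_mul_log_le hΦ (by linarith) hA h2
    have h4 := ih (by linarith)
    push_cast
    linarith

omit [DecidableEq V] in
theorem two_mul_card_edgeFinset_le (G : SimpleGraph V) [DecidableRel G.Adj] :
    2 * (#G.edgeFinset : ℝ) ≤ (Fintype.card V : ℝ) ^ 2 := by
  rw [← sum_degree_eq, sq]
  calc ∑ v, (G.degree v : ℝ) ≤ ∑ _v : V, (Fintype.card V : ℝ) :=
        Finset.sum_le_sum fun v _ => by exact_mod_cast (G.degree_lt_card_verts v).le
    _ = _ := by simp

theorem GreedyRun.length_le (hG : G.Connected) {s : V} {T : ℕ} {σ τ : V → ℕ}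
    (h : GreedyRun G s T σ τ) :
    (T : ℝ) ≤ 56 * (maxEffectiveResistance G s * (#G.edgeFinset : ℝ) ^ 2 *
      Real.log ((Fintype.card V : ℝ) * (chipCount s σ : ℝ))) := by
  obtain ⟨w, hs, h0, hB, hL⟩ := exists_hittingTime hG s
  set R := maxEffectiveResistance G s
  have hR0 : 0 ≤ R := maxEffectiveResistance_nonneg hG s
  set m : ℝ := ((#G.edgeFinset : ℕ) : ℝ)
  have hm0 : 0 ≤ m := Nat.cast_nonneg _
  set Φ : (V → ℕ) → ℝ := fun τ => ∑ v, (τ v : ℝ) * w v with hΦ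
  have hΦ0 : ∀ τ, 0 ≤ Φ τ := fun τ =>
    Finset.sum_nonneg fun v _ => mul_nonneg (Nat.cast_nonneg _) (h0 v)
  set A : ℝ := 4 * m * (2 * m * R) with hA
  have hA0 : 0 ≤ A := by positivity
  have hstep : ∀ σ τ, GreedyStep G s σ τ → Φ τ + 1 ≤ Φ σ ∧ Φ σ ≤ A * (Φ σ - Φ τ) :=
    fun σ τ h => h.potential_drop hG hs hB hL
  -- For `N = 0` this uses the convention `Real.log 0 = 0`.
  have hlog0 : 0 ≤ Real.log ((Fintype.card V : ℝ) * (chipCount s σ : ℝ)) := by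
    rw [← Nat.cast_mul]; exact Real.log_natCast_nonneg _
  cases h with
  | start => simp only [Nat.cast_zero]; positivity
  -- The last iteration is counted separately, because `Φ` may be 0 after it; before it `Φ ρ ≥ 1`.
  | @next T _ ρ τ hrun hlast =>
    obtain ⟨h1, h2⟩ := hstep _ _ hlast
    have hρ1 : 1 ≤ Φ ρ := by linarith [hΦ0 τ]
    have hA1 : 1 ≤ A := by
      have : Φ ρ * 1 ≤ Φ ρ * A := by nlinarith [mul_nonneg hA0 (hΦ0 τ)]
      exact le_of_mul_le_mul_left this (by linarith)
    have hT := hrun.length_le_of_potential hA0 hstep (by linarith)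
    have hlogρ := mul_nonneg hA0 (Real.log_nonneg hρ1)
    -- If `Φ σ < 1`, the bound on `T` forces `T = 0`, so `ρ = σ`, a contradiction.
    have hσ1 : 1 ≤ Φ σ := by
      by_contra hlt
      have := mul_nonpos_of_nonneg_of_nonpos hA0 (Real.log_nonpos (hΦ0 σ) (not_le.1 hlt).le)
      have hT0 : T = 0 := by
        have : (T : ℝ) ≤ 0 := by linarith
        exact_mod_cast le_antisymm this (Nat.cast_nonneg T)
      subst hT0
      cases hrun
      exact hlt hρ1
    have hup : Φ σ ≤ 2 * m * R * chipCount s σ := sum_mul_le_chipCount σ hs hB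
    have hN : 1 ≤ chipCount s σ := by
      by_contra hlt
      have : chipCount s σ = 0 := by omega
      rw [this] at hup
      simp at hup
      linarith
    have hn : 2 ≤ Fintype.card V := by
      obtain ⟨-, u, hu, -⟩ := hlast
      exact Fintype.one_lt_card_iff.2 ⟨u, s, hu⟩
    have hNR : (1 : ℝ) ≤ chipCount s σ := by exact_mod_cast hN
    have hnR : (2 : ℝ) ≤ Fintype.card V := by exact_mod_cast hn
    have hm : 2 * m ≤ (Fintype.card V : ℝ) ^ 2 := two_mul_card_edgeFinset_le G
    have hR : R ≤ 2 * (Fintype.card V : ℝ) ^ 2 := maxEffectiveResistance_le hG s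
    set n : ℝ := (Fintype.card V : ℝ)
    set N : ℝ := (chipCount s σ : ℝ)
    have hΦσ : Φ σ ≤ (n * N) ^ 5 :=
      calc Φ σ ≤ 2 * m * R * N := hup
        -- `2 ≤ n` absorbs the constant in `R ≤ 2 n²`.
        _ ≤ n ^ 2 * (n * n ^ 2) * N := by
          gcongr
          nlinarith [sq_nonneg n]
        _ = n ^ 5 * N := by ring
        _ ≤ n ^ 5 * N ^ 5 := by
          gcongr
          exact le_self_pow₀ hNR (by norm_num)
        _ = (n * N) ^ 5 := by ring
    have hlog : Real.log (Φ σ) ≤ 5 * Real.log (n * N) := by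
      have := Real.log_le_log (by linarith) hΦσ
      rwa [Real.log_pow, Nat.cast_ofNat] at this
    have hlog2 : 1 / 2 ≤ Real.log (n * N) := by
      have h3 : Real.log 2 ≤ Real.log (n * N) := Real.log_le_log (by norm_num) (by nlinarith)
      linarith [Real.log_two_gt_d9]
    set ℓ := Real.log (n * N)
    have h4 : A * Real.log (Φ σ) ≤ A * (5 * ℓ) := mul_le_mul_of_nonneg_left hlog hA0
    have h5 : ℓ ≤ A * ℓ := le_mul_of_one_le_left hlog0 hA1
    -- `56 = 8 * 7`: 8 from `A`, 5 from the exponent in `(n N)^5`, and 2 for the last iteration, as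
    -- `1 ≤ 2 ℓ ≤ 2 A ℓ`.
    have h6 : 56 * (R * m ^ 2 * ℓ) = 7 * (A * ℓ) := by rw [hA]; ring
    rw [h6]
    push_cast
    linarith

theorem exists_greedyRun_isTerminal {s : V} {σ : V → ℕ} {b : ℝ}
    (hb : ∀ T τ, GreedyRun G s T σ τ → (T : ℝ) ≤ b) :
    ∃ T τ, GreedyRun G s T σ τ ∧ IsTerminal G s τ := by
  by_contra! hno
  have hlong : ∀ T, ∃ τ, GreedyRun G s T σ τ := by
    intro T
    induction T with
    | zero => exact ⟨σ, .start σ⟩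
    | succ T ih =>
      obtain ⟨τ, hτ⟩ := ih
      obtain ⟨τ', hs⟩ := (isTerminal_or_exists_greedyStep s τ).resolve_left (hno T τ hτ)
      exact ⟨τ', hτ.next hs⟩
  obtain ⟨T, hT⟩ := exists_nat_gt b
  obtain ⟨τ, hτ⟩ := hlong T
  exact (hb T τ hτ).not_gt hT

end Firing

theorem theorem3 :
    ∃ C : ℝ, 0 < C ∧
      ∀ (V : Type*) [Fintype V] [DecidableEq V] (G : SimpleGraph V) [DecidableRel G.Adj]
        (_hG : G.Connected) (s : V) (σ : V → ℕ),
        (∀ (T : ℕ) (τ : V → ℕ), GreedyRun G s T σ τ →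
          (T : ℝ) ≤ C * (maxEffectiveResistance G s * (G.edgeFinset.card : ℝ) ^ 2 *
              Real.log ((Fintype.card V : ℝ) * (chipCount s σ : ℝ))) ∧
            FiringReachable G s σ τ ∧
            (IsTerminal G s τ ∨ ∃ τ', GreedyStep G s τ τ')) ∧
        ∃ (T : ℕ) (τ : V → ℕ), GreedyRun G s T σ τ ∧ IsTerminal G s τ :=
  ⟨56, by norm_num, fun _ _ _ _ _ hG s _ =>
    ⟨fun _ τ h => ⟨h.length_le hG, h.firingReachable, isTerminal_or_exists_greedyStep s τ⟩,
      exists_greedyRun_isTerminal fun _ _ h => h.length_le hG⟩⟩
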